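/- \textbf{Model.} For $n\ge 1$, an unoriented ring consists of nodes $v_i$, $i\in\mathbb Z/n\mathbb Z$, where $v_i$ is linked to $v_{i-1}$ and to $v_{i+1}$ through two local ports labelled $0$ and $1$; which of the two ports leads to $v_{i+1}$ is chosen arbitrarily and independently at every node (for $n=2$ there are two parallel links, for $n=1$ the two ports of the only node are linked to each other). The nodes have pairwise distinct identifiers $\mathsf{ID}(v)\in\mathbb N$; put $\mathsf{ID}_{\max}=\max_v \mathsf{ID}(v)$. The only messages are \emph{pulses}, which carry no content. A uniform deterministic content-oblivious algorithm is one and the same computable deterministic state machine run by every node, whose initial input is the identifier of the node only (in particular neither $n$ nor an orientation of the ring is known). A node acts only at initialization and upon receiving a pulse; it knows the port through which the pulse arrives, and in each action it updates its state and sends any finite number of pulses through each of its ports. Every node has a binary output, $\mathsf{Leader}$ or $\mathsf{Non\text{-}Leader}$, and may declare termination, after which it ignores all pulses and its output is fixed. Executions are asynchronous: all nodes are initialized, and then, as long as pulses are in transit, a scheduler picks an arbitrary one and delivers it. A node \emph{quiescently terminates} at time $t$ if it declares termination at time $t$ and no pulse arrives at it thereafter. \textbf{Theorem.} There is a uniform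 deterministic content-oblivious algorithm such that, for every $n\ge 1$, every unoriented ring on $n$ nodes with pairwise distinct identifiers, and every asynchronous execution on it: every node eventually quiescently terminates; the node with identifier $\mathsf{ID}_{\max}$ finally outputs $\mathsf{Leader}$ and every other node finally outputs $\mathsf{Non\text{-}Leader}$; the leader terminates after all other nodes; and the total number of pulses sent is at most $n(4\,\mathsf{ID}_{\max}+3)$, hence $O(n\cdot\mathsf{ID}_{\max})$, with an absolute constant, whenever $\mathsf{ID}_{\max}\ge 1$. -/

import Mathlib

namespace ContentOblivious

/-- The two local port labels of a node of a ring: port `0` is `false`, port `1` is `true`. -/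
abbrev Port := Bool

/-- The pulses a node emits in one action: `(number sent on port 0, number sent on port 1)`. -/
abbrev Emission := ℕ × ℕ

/-- The number of pulses of an emission that leave through port `p`. -/
def Emission.on (e : Emission) (p : Port) : ℕ := if p then e.2 else e.1

/-- A uniform deterministic content-oblivious algorithm for nodes with two ports.  A node acts
only at initialization, when it knows nothing but its own identifier, and on the arrival of a
pulse, when it knows nothing but its local state and the port of arrival.  Each action changes the
local state and emits finitely many pulses.  The state carries the binary output variable
`isLeader` and the declaration of termination.  All local computations are computable. -/
structure Algorithm where
  State : Type
  [primcodable : Primcodable State]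
  init : ℕ → State × Emission
  step : State → Port → State × Emission
  isLeader : State → Bool
  terminated : State → Bool
  computable_init : Computable init
  computable_step : Computable₂ step
  computable_isLeader : Computable isLeader
  computable_terminated : Computable terminated

/-- The ring on `n` nodes, indexed modulo `n`; `succPort v` is the label, at node `v`, of the port
that leads to `v + 1`, and the other port of `v` leads to `v - 1`.  `peer succPort v p` is the
other end (node and port there) of the link attached to port `p` of node `v`.  For `n = 2` the two
nodes are joined by two links; for `n = 1` the two ports of the node are joined to each other. -/
def peer {n : ℕ} (succPort : ZMod n → Port) (v : ZMod n) (p : Port) : ZMod n × Port :=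
  if p = succPort v then (v + 1, !succPort (v + 1)) else (v - 1, succPort (v - 1))

/-- Links are symmetric. -/
theorem peer_peer {n : ℕ} (succPort : ZMod n → Port) (v : ZMod n) (p : Port) :
    peer succPort (peer succPort v p).1 (peer succPort v p).2 = (v, p) := by
  by_cases h : p = succPort v
  · simp [peer, h]
  · have h' : (!succPort v) = p := by
      cases p <;> cases hs : succPort v <;> simp_all
    simp [peer, h, h']

/-- A global configuration: the local states, the number `transit v p` of pulses in transit
towards port `p` of node `v`, and the total number of pulses sent so far. -/
structure Config (A : Algorithm) (n : ℕ) where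
  state : ZMod n → A.State
  transit : ZMod n → Port → ℕ
  sent : ℕ

/-- The configuration right after all nodes have been initialized with their identifiers. -/
def Config.initial (A : Algorithm) {n : ℕ} [NeZero n] (succPort : ZMod n → Port)
    (ID : ZMod n → ℕ) : Config A n where
  state v := (A.init (ID v)).1
  transit v p := (A.init (ID (peer succPort v p).1)).2.on (peer succPort v p).2
  sent := ∑ v, ((A.init (ID v)).2.on false + (A.init (ID v)).2.on true)

/-- The reaction of a node in state `s` to a pulse on port `p`.  A node that has declared
termination ignores the pulse. -/
def Algorithm.react (A : Algorithm) (s : A.State) (p : Port) : A.State × Emission :=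
  if A.terminated s then (s, (0, 0)) else A.step s p

/-- Delivery of one pulse that is in transit towards port `p` of node `v`. -/
def Config.deliver {A : Algorithm} {n : ℕ} (succPort : ZMod n → Port) (c : Config A n)
    (v : ZMod n) (p : Port) : Config A n where
  state := Function.update c.state v (A.react (c.state v) p).1
  transit w q :=
    (if w = v ∧ q = p then c.transit w q - 1 else c.transit w q) +
      (if (peer succPort w q).1 = v then
        (A.react (c.state v) p).2.on (peer succPort w q).2 else 0)
  sent := c.sent + ((A.react (c.state v) p).2.on false + (A.react (c.state v) p).2.on true)

/-- An asynchronous execution.  `c t` is the configuration at time `t` (just before the `t`-th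
choice of the scheduler).  As long as pulses are in transit, the scheduler delivers an arbitrary
one of them: `sched t = some (v, p)` means that at time `t` a pulse is delivered to port `p` of
node `v`, and `sched t = none` that no pulse is in transit, in which case nothing happens. -/
structure IsExecution (A : Algorithm) {n : ℕ} [NeZero n] (succPort : ZMod n → Port)
    (ID : ZMod n → ℕ) (sched : ℕ → Option (ZMod n × Port)) (c : ℕ → Config A n) : Prop where
  start : c 0 = Config.initial A succPort ID
  deliver : ∀ t v p, sched t = some (v, p) →
    0 < (c t).transit v p ∧ c (t + 1) = (c t).deliver succPort v p
  idle : ∀ t, sched t = none → (∀ v p, (c t).transit v p = 0) ∧ c (t + 1) = c t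

/-- Node `v` declares termination at time `t`. -/
def TerminatesAt {A : Algorithm} {n : ℕ} (c : ℕ → Config A n) (v : ZMod n) (t : ℕ) : Prop :=
  A.terminated ((c t).state v) = true ∧ ∀ s < t, A.terminated ((c s).state v) = false

/-- Node `v` terminates at time `t` and no pulse arrives at `v` from then on. -/
def QuiescentlyTerminatesAt {A : Algorithm} {n : ℕ} (sched : ℕ → Option (ZMod n × Port))
    (c : ℕ → Config A n) (v : ZMod n) (t : ℕ) : Prop :=
  TerminatesAt c v t ∧ ∀ s, t ≤ s → ∀ p, sched s ≠ some (v, p)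

end ContentOblivious

/-!
A node with identifier `m` remembers only `m` and the numbers `a`, `b` of pulses received so far on
ports `0` and `1`; the numbers of pulses it has sent are functions `out0 m a b`, `out1 m a b` of
these. It goes through three modes, according to `k = min a b`.

* For `k < 2 * m` it is *active*: it keeps the pulses of the two directions in lockstep, sending the
  `(k + 1)`-st pulse on both ports once `k` pulses have arrived on both.
* For `2 * m ≤ k < 2 * m + 2` it is *testing* whether it is alone: it pushes up to two extra pulses
  out of port `0` and otherwise forwards, holding back on port `1` whatever exceeds `2 * m + 2`.
* For `2 * m + 2 ≤ k` it is *passive* and forwards every pulse.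

If a testing node gets both extra pulses back on port `1` while port `0` is still silent, i.e. at
`(a, b) = (2 * m, 2 * m + 2)`, it *claims* leadership and sends a third extra pulse out of port `0`.
This is sound (`Snapshot.Claims.other`): going back from the claimant along the stream of extra
pulses, an active node would have kept the directions within one pulse of each other, and a testing
node has another identifier and hence another threshold, so every node met is passive; a passive node
has seen more than `2 * m'` pulses in both directions, so its identifier `m'` is smaller.
Conversely, as long as nobody claims, the two directions differ by at most two pulses at every
passive node (`Snapshot.Causal.out_le`). A difference of three therefore announces the pulse of the
leader: a passive node that observes it forwards the pulse and terminates, and the leader terminates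
when the pulse has come round. Finally, every node has received `2 * M` pulses in one direction and
`2 * M + 3` in the other, where `M` is the largest identifier; this gives the message bound.

No deadlock arises before a claim (`Snapshot.Bounded.claims_of_quiescent`): if nothing is in
transit, the direction and place where the fewest pulses were received force that same number all
around the ring, which leaves only the node with the largest identifier testing; it then adds a
pulse to the other direction that would have to circulate consistently, a contradiction.

All of this except the evolution in time is a consequence of the inequalities "received from a
neighbour is at most what the neighbour sent", and is proved for a `Snapshot` satisfying these.
-/

namespace PulseElection

open ContentOblivious

/-! ### The numbers of pulses sent, as functions of the numbers received -/

/-- The number of pulses a node with identifier `m` has sent on port `0` when it has received `a`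
pulses on port `0` and `b` on port `1`. The value `2 * m + 3` includes the announcement made by a
node that claims leadership. -/
def out0 (m a b : ℕ) : ℕ :=
  if min a b < 2 * m then min a b + 1
  else if min a b < 2 * m + 2 then
    (if b < 2 * m + 1 then 2 * m + 1 else if b < 2 * m + 2 ∨ 2 * m < a then 2 * m + 2
      else 2 * m + 3)
  else b

/-- The number of pulses a node with identifier `m` has sent on port `1` when it has received `a`
pulses on port `0` and `b` on port `1`. -/
def out1 (m a b : ℕ) : ℕ :=
  if min a b < 2 * m then min a b + 1
  else if min a b < 2 * m + 2 then min a (2 * m + 2)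
  else a

/-! ### Flows of pulses around the ring at a fixed moment -/

section Ring

variable {n : ℕ}

/-- The two directions of travel around the ring, as displacements: `true` is `v ↦ v + 1` and
`false` is `v ↦ v - 1`. -/
def dir (n : ℕ) (d : Bool) : ZMod n := if d then 1 else -1

theorem dir_not (d : Bool) : dir n (!d) = - dir n d := by cases d <;> simp [dir]

theorem ring_induction [NeZero n] {P : ZMod n → Prop} (d : Bool) (u : ZMod n) (h0 : P u)
    (h : ∀ v, P v → P (v + dir n d)) (v : ZMod n) : P v := by
  have key : ∀ k : ℕ, P (u + k * dir n d) := by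
    intro k
    induction k with
    | zero => simpa using h0
    | succ k ih =>
      have := h _ ih
      push_cast
      rwa [add_mul, one_mul, ← add_assoc]
  cases d
  · have := key (u - v).val
    simpa [dir] using this
  · have := key (v - u).val
    simpa [dir] using this

/-- A moment of an execution, described in terms of the directions of travel instead of the local
ports: `orient v` is the direction in which port `0` of `v` sends, and `recv d v` is the number of
pulses travelling in direction `d` that `v` has received. -/
structure Snapshot (n : ℕ) where
  ID : ZMod n → ℕ
  inj : Function.Injective ID
  orient : ZMod n → Bool
  recv : Bool → ZMod n → ℕ

namespace Snapshot

variable (S : Snapshot n)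

/-- The number of pulses that `v` has sent in direction `d`. Port `0` of `v` receives the pulses that
travel in direction `!orient v`. -/
def out (d : Bool) (v : ZMod n) : ℕ :=
  if d = S.orient v then out0 (S.ID v) (S.recv (!d) v) (S.recv d v)
  else out1 (S.ID v) (S.recv d v) (S.recv (!d) v)

/-- A passive node forwards every pulse. -/
def Passive (v : ZMod n) : Prop := ∀ d, 2 * S.ID v + 2 ≤ S.recv d v

/-- The node `v` claims leadership: its two extra pulses have come round, and none came against
them. -/
def Claims (v : ZMod n) : Prop :=
  S.recv (!S.orient v) v = 2 * S.ID v ∧ 2 * S.ID v + 2 ≤ S.recv (S.orient v) v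

/-- No node has received more pulses than its neighbours sent to it. -/
def Causal : Prop := ∀ d v, S.recv d (v + dir n d) ≤ S.out d v

variable {S}

theorem Causal.le_out_sub (hS : S.Causal) (d : Bool) (v : ZMod n) :
    S.recv d v ≤ S.out d (v + dir n (!d)) := by
  have := hS d (v + dir n (!d))
  rwa [dir_not, neg_add_cancel_right, ← dir_not] at this

theorem Passive.out_eq {v : ZMod n} (h : S.Passive v) (d : Bool) : S.out d v = S.recv d v := by
  have h1 := h d
  have h2 := h (!d)
  unfold out out0 out1
  split_ifs <;> omega

theorem passive_iff (d : Bool) (v : ZMod n) :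
    S.Passive v ↔ 2 * S.ID v + 2 ≤ S.recv d v ∧ 2 * S.ID v + 2 ≤ S.recv (!d) v := by
  cases d <;> simp [Passive, and_comm]

theorem out_le_recv_add_two {v : ZMod n} (hp : ¬ S.Passive v) (hc : ¬ S.Claims v) (d : Bool) :
    S.out d v ≤ S.recv (!d) v + 2 := by
  rw [passive_iff d] at hp
  unfold Claims at hc
  unfold out out0 out1
  by_cases h : d = S.orient v
  · rw [← h] at hc
    split_ifs <;> omega
  · split_ifs <;> omega

/-- Before any claim, no node is ahead by more than two pulses in either direction. Passive nodes
inherit the bound from the preceding node; some node that is not passive is needed to start. -/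
theorem Causal.out_le [NeZero n] (hS : S.Causal) {u : ZMod n} (hu : ¬ S.Passive u)
    (hc : ∀ v, ¬ S.Claims v) (d : Bool) (v : ZMod n) : S.out d v ≤ S.recv (!d) v + 2 := by
  refine ring_induction (P := fun v => S.out d v ≤ S.recv (!d) v + 2) d u
    (out_le_recv_add_two hu (hc u) d) (fun w hw => ?_) v
  by_cases hp : S.Passive (w + dir n d)
  · have h1 := hS d w
    have h2 := hS.le_out_sub (!d) w
    rw [Bool.not_not] at h2
    rw [hp.out_eq] at h2 ⊢
    omega
  · exact out_le_recv_add_two hp (hc _) d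

theorem Claims.out_not {v : ZMod n} (h : S.Claims v) :
    S.out (!S.orient v) v = 2 * S.ID v := by
  obtain ⟨h1, h2⟩ := h
  unfold out out1
  simp only [Bool.not_not, h1, Bool.not_eq_self, if_false]
  split_ifs <;> omega

/-- A node that lets through two pulses against a silent opposite direction is passive, unless its
identifier is the `m` at which the opposite direction has stopped. -/
theorem passive_of_lag (d : Bool) {u : ZMod n} {m : ℕ} (hm : S.ID u ≠ m)
    (h1 : 2 * m + 2 ≤ S.out d u) (h2 : S.recv (!d) u ≤ 2 * m) : S.Passive u := by
  rw [passive_iff d]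
  unfold out out0 out1 at h1
  split_ifs at h1 <;> omega

/-- A node that claims leadership is the only one that is not passive. -/
theorem Claims.other [NeZero n] (hS : S.Causal) {v : ZMod n} (h : S.Claims v) (u : ZMod n)
    (hu : u ≠ v) : S.Passive u ∧ S.recv (!S.orient v) u = 2 * S.ID v ∧
      2 * S.ID v + 2 ≤ S.recv (S.orient v) u := by
  -- walk against the stream of extra pulses
  have key : ∀ u, 2 * S.ID v + 2 ≤ S.recv (S.orient v) u ∧
      S.out (!S.orient v) u ≤ 2 * S.ID v ∧ (u ≠ v → S.Passive u) := by
    refine ring_induction (!S.orient v) v ⟨h.2, h.out_not.le, fun h => absurd rfl h⟩ ?_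
    rintro w ⟨hw1, hw2, -⟩
    have h1 := hS.le_out_sub (S.orient v) w
    have h2 := hS (!S.orient v) w
    by_cases hv : w + dir n (!S.orient v) = v
    · rw [hv]
      exact ⟨h.2, h.out_not.le, fun h => absurd rfl h⟩
    · have hp := passive_of_lag (S.orient v) (fun e => hv (S.inj e)) (hw1.trans h1) (h2.trans hw2)
      rw [hp.out_eq] at h1 ⊢
      exact ⟨hw1.trans h1, h2.trans hw2, fun _ => hp⟩
  have key2 : ∀ u, 2 * S.ID v ≤ S.recv (!S.orient v) u := by
    refine ring_induction (S.orient v) v h.1.ge fun w hw => ?_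
    by_cases hv : w + dir n (S.orient v) = v
    · rw [hv]; exact h.1.ge
    · have h1 := hS.le_out_sub (!S.orient v) w
      rw [Bool.not_not, ((key _).2.2 hv).out_eq] at h1
      exact hw.trans h1
  have hp := (key u).2.2 hu
  refine ⟨hp, le_antisymm ?_ (key2 u), (key u).1⟩
  have := (key u).2.1
  rwa [hp.out_eq] at this

theorem Claims.eq_of_max [NeZero n] (hS : S.Causal) {v L : ZMod n} (h : S.Claims v)
    (hL : ∀ u, S.ID u ≤ S.ID L) : v = L := by
  by_contra hne
  obtain ⟨hp, h1, -⟩ := h.other hS L (Ne.symm hne)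
  have := hp (!S.orient v)
  have := hL v
  omega

/-- The inequalities that hold throughout an execution, `L` being the node with the largest
identifier. The directions are named after port `0` of `L`. -/
structure Bounded (S : Snapshot n) (L : ZMod n) : Prop where
  causal : S.Causal
  id_le : ∀ u, S.ID u ≤ S.ID L
  recv_not_le : ∀ u, S.recv (!S.orient L) u ≤ 2 * S.ID L
  recv_le : ∀ u, S.recv (S.orient L) u ≤ 2 * S.ID L + 3

namespace Bounded

variable {L : ZMod n}

theorem not_passive (h : S.Bounded L) : ¬ S.Passive L := fun hp => by
  have := hp (!S.orient L)
  have := h.recv_not_le L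
  omega

variable [NeZero n]

theorem out_le_of_ne (h : S.Bounded L) {u : ZMod n} (hu : u ≠ L) (d : Bool) :
    S.out d u ≤ max (S.recv d u) (2 * S.ID L) := by
  have h1 := h.id_le u
  have h2 : S.ID u ≠ S.ID L := fun e => hu (S.inj e)
  have hc : ¬ S.Claims u := fun hc => hu (hc.eq_of_max h.causal h.id_le)
  unfold Claims at hc
  unfold out out0 out1
  by_cases ho : d = S.orient u
  · rw [← ho] at hc
    split_ifs <;> omega
  · split_ifs <;> omega

theorem out_not_le (h : S.Bounded L) (u : ZMod n) :
    S.out (!S.orient L) u ≤ 2 * S.ID L := by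
  have h1 := h.recv_not_le u
  by_cases hu : u = L
  · subst hu
    unfold out out1
    simp only [Bool.not_not, Bool.not_eq_self, if_false]
    split_ifs <;> omega
  · exact (h.out_le_of_ne hu _).trans (max_le h1 le_rfl)

theorem out_le (h : S.Bounded L) (u : ZMod n) :
    S.out (S.orient L) u ≤ 2 * S.ID L + 3 := by
  have h1 := h.recv_le u
  by_cases hu : u = L
  · subst hu
    have h2 := h.recv_not_le u
    unfold out out0
    simp only [if_true]
    split_ifs <;> omega
  · exact (h.out_le_of_ne hu _).trans (max_le h1 (by omega))

end Bounded

/-- The condition for termination: a passive node has seen one direction ahead by three pulses, or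
the announcement of a claiming node has come round. -/
def Done (S : Snapshot n) (v : ZMod n) : Prop :=
  (S.Passive v ∧ ∃ d, S.recv (!d) v + 3 ≤ S.recv d v) ∨
    (S.Claims v ∧ 2 * S.ID v + 3 ≤ S.recv (S.orient v) v)

namespace Bounded

variable [NeZero n] {L : ZMod n}

theorem claims_of_done (h : S.Bounded L) {v : ZMod n} (hv : S.Done v) : S.Claims L := by
  by_contra hc
  have hc' : ∀ u, ¬ S.Claims u := fun u hu => hc (hu.eq_of_max h.causal h.id_le ▸ hu)
  rcases hv with ⟨hp, d, hd⟩ | ⟨hv, -⟩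
  · have := h.causal.out_le h.not_passive hc' d v
    rw [hp.out_eq] at this
    omega
  · exact hc' v hv

theorem done_iff (h : S.Bounded L) (hc : S.Claims L) (v : ZMod n) :
    S.Done v ↔ 2 * S.ID L + 3 ≤ S.recv (S.orient L) v := by
  by_cases hv : v = L
  · subst hv
    simp [Done, hc, h.not_passive]
  · obtain ⟨hp, h1, h2⟩ := hc.other h.causal v hv
    have hc' : ¬ S.Claims v := fun hc => hv (hc.eq_of_max h.causal h.id_le)
    simp only [Done, hp, hc', true_and, false_and, or_false]
    constructor
    · rintro ⟨d, hd⟩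
      by_cases ho : d = S.orient L
      · subst ho; omega
      · rw [Bool.eq_not_of_ne ho, Bool.not_not] at hd
        omega
    · intro h3
      exact ⟨S.orient L, by omega⟩

theorem recv_of_done (h : S.Bounded L) {v : ZMod n} (hv : S.Done v) :
    S.recv (S.orient L) v = 2 * S.ID L + 3 ∧ S.recv (!S.orient L) v = 2 * S.ID L := by
  have hc := h.claims_of_done hv
  refine ⟨le_antisymm (h.recv_le v) ((h.done_iff hc v).1 hv), ?_⟩
  by_cases e : v = L
  · rw [e]; exact hc.1
  · exact (hc.other h.causal v e).2.1

theorem all_done (h : S.Bounded L) (hL : S.Done L) (v : ZMod n) : S.Done v := by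
  have hc := h.claims_of_done hL
  rw [h.done_iff hc] at hL ⊢
  refine ring_induction (P := fun v => 2 * S.ID L + 3 ≤ S.recv (S.orient L) v)
    (!S.orient L) L hL (fun w hw => ?_) v
  by_cases e : w + dir n (!S.orient L) = L
  · rwa [e]
  · have h1 := h.causal.le_out_sub (S.orient L) w
    rw [(hc.other h.causal _ e).1.out_eq] at h1
    exact hw.trans h1

/-- The algorithm does not get stuck: if nothing is in transit, the leader has been found. -/
theorem claims_of_quiescent (h : S.Bounded L) (hq : ∀ d v, S.recv d (v + dir n d) = S.out d v) :
    S.Claims L := by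
  by_contra hc
  -- a direction and a node where the number of received pulses is smallest
  obtain ⟨⟨e, v⟩, hmin⟩ := Finite.exists_min (fun x : Bool × ZMod n => S.recv x.1 x.2)
  have hmin' : ∀ d u, S.recv e v ≤ S.recv d u := fun d u => hmin (d, u)
  set k := S.recv e v with hk
  -- sending only `k` pulses requires having received only `k`, and rules out the active mode
  have hloc : ∀ u, S.out e u = k → S.recv e u = k ∧ 2 * S.ID u ≤ k ∧
      (e = S.orient u → S.Passive u) := by
    intro u hu
    have h1 := hmin' e u
    have h2 := hmin' (!e) u
    rw [passive_iff e]
    unfold out out0 out1 at hu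
    split_ifs at hu <;> simp_all <;> omega
  have hall : ∀ u, S.recv e u = k := by
    refine ring_induction (!e) v rfl fun w hw => (hloc _ ?_).1
    rw [← hq, dir_not, neg_add_cancel_right, hw]
  have hloc' : ∀ u, 2 * S.ID u ≤ k ∧ (e = S.orient u → S.Passive u) := fun u =>
    (hloc u (by rw [← hq, hall])).2
  have he : e = !S.orient L := by
    by_contra hne
    exact h.not_passive ((hloc' L).2 (by simpa using Bool.eq_not_of_ne hne))
  have hkL : k = 2 * S.ID L := by
    have h1 := h.recv_not_le L
    rw [← he, hall] at h1
    have := (hloc' L).1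
    omega
  have hpass : ∀ u, u ≠ L → S.Passive u := by
    intro u hu d
    have := hmin' d u
    have h1 := h.id_le u
    have h2 : S.ID u ≠ S.ID L := fun e => hu (S.inj e)
    omega
  have hflow : ∀ u, S.recv (S.orient L) (u + dir n (S.orient L)) = S.out (S.orient L) L := by
    refine ring_induction (S.orient L) L (hq _ _) fun w hw => ?_
    by_cases e : w + dir n (S.orient L) = L
    · rw [hq, e]
    · rw [hq, (hpass _ e).out_eq, hw]
  -- the extra pulses of `L` have all come back, contrary to `out0 > recv` for a testing node
  have h1 := hflow (L + dir n (!S.orient L))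
  rw [dir_not, neg_add_cancel_right] at h1
  have h2 := hmin' (S.orient L) L
  have h3 := hall L
  rw [he] at h3
  unfold Claims at hc
  unfold out out0 at h1
  simp only [if_true, h3] at h1 hc
  split_ifs at h1 <;> omega

theorem done_of_quiescent (h : S.Bounded L) (hq : ∀ d v, S.recv d (v + dir n d) = S.out d v)
    (v : ZMod n) : S.Done v := by
  have hc := h.claims_of_quiescent hq
  rw [h.done_iff hc]
  have h0 : S.out (S.orient L) L = 2 * S.ID L + 3 := by
    obtain ⟨h1, h2⟩ := hc
    unfold out out0
    simp only [if_true, h1]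
    split_ifs <;> omega
  have hflow : ∀ u, S.recv (S.orient L) (u + dir n (S.orient L)) = S.out (S.orient L) L := by
    refine ring_induction (S.orient L) L (hq _ _) fun w hw => ?_
    by_cases e : w + dir n (S.orient L) = L
    · rw [hq, e]
    · rw [hq, (hc.other h.causal _ e).1.out_eq, hw]
  have h1 := hflow (v + dir n (!S.orient L))
  rw [dir_not, neg_add_cancel_right, h0] at h1
  exact h1.ge

end Bounded

end Snapshot

end Ring

/-! ### The algorithm and its computability -/

/-- The identifier of the node and the numbers of pulses received on ports `0` and `1`. -/
abbrev LocalState := ℕ × ℕ × ℕ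

/-- The number of pulses received on port `p`. -/
def count (s : LocalState) (p : Port) : ℕ := if p then s.2.2 else s.2.1

/-- The number of pulses sent on port `p`. -/
def total (s : LocalState) (p : Port) : ℕ :=
  if p then out1 s.1 s.2.1 s.2.2 else out0 s.1 s.2.1 s.2.2

/-- The state after the arrival of a pulse on port `p`. -/
def bump (s : LocalState) (p : Port) : LocalState :=
  (s.1, if p then s.2.1 else s.2.1 + 1, if p then s.2.2 + 1 else s.2.2)

/-- The pulses sent on the arrival of a pulse on port `p`. The subtraction truncates only when a
claiming node receives a pulse on port `0`, which never happens (`Invariant.not_elected`). -/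
def emission (s : LocalState) (p : Port) : Emission :=
  (total (bump s p) false - total s false, total (bump s p) true - total s true)

/-- The node declares termination; see `Snapshot.Done`. -/
def finished (s : LocalState) : Bool :=
  decide ((2 * s.1 + 2 ≤ min s.2.1 s.2.2 ∧ (s.2.1 + 3 ≤ s.2.2 ∨ s.2.2 + 3 ≤ s.2.1)) ∨
    (s.2.1 = 2 * s.1 ∧ 2 * s.1 + 3 ≤ s.2.2))

/-- The output `Leader`; see `Snapshot.Claims`. -/
def elected (s : LocalState) : Bool := decide (s.2.1 = 2 * s.1 ∧ 2 * s.1 + 2 ≤ s.2.2)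

section Computability

open Primrec

theorem primrec_two_mul_add {α : Type*} [Primcodable α] {f : α → ℕ} (hf : Primrec f) (k : ℕ) :
    Primrec fun x => 2 * f x + k :=
  nat_add.comp (nat_mul.comp (.const 2) hf) (.const k)

theorem primrec_out0 {α : Type*} [Primcodable α] {f g h : α → ℕ} (hf : Primrec f)
    (hg : Primrec g) (hh : Primrec h) : Primrec fun x => out0 (f x) (g x) (h x) := by
  have hk : Primrec fun x => min (g x) (h x) := nat_min.comp hg hh
  have e := fun k => primrec_two_mul_add hf k
  unfold out0
  exact .ite (nat_lt.comp hk (e 0)) (succ.comp hk) (.ite (nat_lt.comp hk (e 2))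
    (.ite (nat_lt.comp hh (e 1)) (e 1)
      (.ite ((nat_lt.comp hh (e 2)).or (nat_lt.comp (e 0) hg)) (e 2) (e 3))) hh)

theorem primrec_out1 {α : Type*} [Primcodable α] {f g h : α → ℕ} (hf : Primrec f)
    (hg : Primrec g) (hh : Primrec h) : Primrec fun x => out1 (f x) (g x) (h x) := by
  have hk : Primrec fun x => min (g x) (h x) := nat_min.comp hg hh
  have e := fun k => primrec_two_mul_add hf k
  unfold out1
  exact .ite (nat_lt.comp hk (e 0)) (succ.comp hk) (.ite (nat_lt.comp hk (e 2))
    (nat_min.comp hg (e 2)) hg)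

theorem primrec_total (p : Port) : Primrec fun s => total s p := by
  have h1 : Primrec fun s : LocalState => s.1 := fst
  have h2 : Primrec fun s : LocalState => s.2.1 := fst.comp snd
  have h3 : Primrec fun s : LocalState => s.2.2 := snd.comp snd
  cases p
  · simpa [total] using primrec_out0 h1 h2 h3
  · simpa [total] using primrec_out1 h1 h2 h3

theorem primrec_bump : Primrec₂ bump := by
  have h1 : Primrec fun x : LocalState × Port => x.1.1 := fst.comp fst
  have h2 : Primrec fun x : LocalState × Port => x.1.2.1 := fst.comp (snd.comp fst)
  have h3 : Primrec fun x : LocalState × Port => x.1.2.2 := snd.comp (snd.comp fst)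
  have hp : PrimrecPred fun x : LocalState × Port => x.2 = true := Primrec.eq.comp snd (.const true)
  exact h1.pair ((ite hp h2 (succ.comp h2)).pair (ite hp (succ.comp h3) h3))

theorem primrec_emission : Primrec₂ emission := by
  have h (p : Port) : Primrec fun x : LocalState × Port =>
      total (bump x.1 x.2) p - total x.1 p :=
    nat_sub.comp ((primrec_total p).comp primrec_bump) ((primrec_total p).comp fst)
  exact (h false).pair (h true)

theorem primrec_finished : Primrec finished := by
  have h1 : Primrec fun s : LocalState => s.1 := fst
  have h2 : Primrec fun s : LocalState => s.2.1 := fst.comp snd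
  have h3 : Primrec fun s : LocalState => s.2.2 := snd.comp snd
  have e := fun k => primrec_two_mul_add h1 k
  have k3 (f : LocalState → ℕ) (hf : Primrec f) : Primrec fun s => f s + 3 :=
    nat_add.comp hf (.const 3)
  exact PrimrecPred.decide (((nat_le.comp (e 2) (nat_min.comp h2 h3)).and
    ((nat_le.comp (k3 _ h2) h3).or (nat_le.comp (k3 _ h3) h2))).or
    ((Primrec.eq.comp h2 (e 0)).and (nat_le.comp (e 3) h3)))

theorem primrec_elected : Primrec elected := by
  have h1 : Primrec fun s : LocalState => s.1 := fst
  have h2 : Primrec fun s : LocalState => s.2.1 := fst.comp snd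
  have h3 : Primrec fun s : LocalState => s.2.2 := snd.comp snd
  have e := fun k => primrec_two_mul_add h1 k
  exact PrimrecPred.decide ((Primrec.eq.comp h2 (e 0)).and (nat_le.comp (e 2) h3))

end Computability

/-- The leader election algorithm. It is reducible so that its states are seen to be elements of
`LocalState`. -/
abbrev algorithm : Algorithm where
  State := LocalState
  init m := ((m, 0, 0), (total (m, 0, 0) false, total (m, 0, 0) true))
  step s p := (bump s p, emission s p)
  isLeader := elected
  terminated := finished
  computable_init := by
    have h : Primrec fun m : ℕ => ((m, 0, 0) : LocalState) := Primrec.id.pair (.const _)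
    exact (h.pair (((primrec_total false).comp h).pair ((primrec_total true).comp h))).to_comp
  computable_step := (Primrec.pair primrec_bump primrec_emission).to_comp
  computable_isLeader := primrec_elected.to_comp
  computable_terminated := primrec_finished.to_comp

/-! ### Executions -/

section Execution

variable {n : ℕ}

/-- The port of `v` that sends in direction `d`. It receives the pulses that travel in direction
`!d`. -/
def port (succPort : ZMod n → Port) (d : Bool) (v : ZMod n) : Port :=
  if d then succPort v else !succPort v

theorem port_not (succPort : ZMod n → Port) (d : Bool) (v : ZMod n) :
    port succPort (!d) v = !port succPort d v := by cases d <;> simp [port]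

theorem exists_port (succPort : ZMod n → Port) (v : ZMod n) (p : Port) :
    ∃ d, p = port succPort d v := by
  cases p <;> cases h : succPort v <;> simp [port, h]

theorem peer_port (succPort : ZMod n → Port) (d : Bool) (v : ZMod n) :
    peer succPort v (port succPort d v) = (v + dir n d, port succPort (!d) (v + dir n d)) := by
  cases d <;> simp [peer, port, dir, sub_eq_add_neg]

/-- The description of the local states `st` in terms of directions of travel. -/
def snapshot (succPort : ZMod n → Port) {ID : ZMod n → ℕ} (hID : Function.Injective ID)
    (st : ZMod n → LocalState) : Snapshot n where
  ID := ID
  inj := hID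
  orient v := !succPort v
  recv d v := count (st v) (port succPort (!d) v)

/-- The invariant of executions: every pulse sent has been received or is in transit, and the
numbers of pulses received obey the bounds in terms of the largest identifier. -/
structure Invariant (succPort : ZMod n → Port) {ID : ZMod n → ℕ} (hID : Function.Injective ID)
    [NeZero n] (L : ZMod n) (c : Config algorithm n) : Prop where
  id_eq : ∀ v, (c.state v).1 = ID v
  link : ∀ v p, count (c.state v) p + c.transit v p =
    total (c.state (peer succPort v p).1) (peer succPort v p).2
  sent_eq : c.sent = ∑ v, (total (c.state v) false + total (c.state v) true)
  bounded : (snapshot succPort hID c.state).Bounded L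

variable {succPort : ZMod n → Port} {ID : ZMod n → ℕ} {hID : Function.Injective ID}

theorem snapshot_out {st : ZMod n → LocalState} (h : ∀ v, (st v).1 = ID v) (d : Bool)
    (v : ZMod n) : (snapshot succPort hID st).out d v = total (st v) (port succPort d v) := by
  cases d <;> cases hs : succPort v <;>
    simp [Snapshot.out, snapshot, total, count, port, hs, h]

theorem done_iff_finished {st : ZMod n → LocalState} (h : ∀ v, (st v).1 = ID v) (v : ZMod n) :
    (snapshot succPort hID st).Done v ↔ finished (st v) = true := by
  have e := h v
  cases hs : succPort v <;>
    simp [Snapshot.Done, Snapshot.Passive, Snapshot.Claims, snapshot, finished, count, port, hs, h] <;>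
    omega

theorem claims_iff_elected {st : ZMod n → LocalState} (h : ∀ v, (st v).1 = ID v) (v : ZMod n) :
    (snapshot succPort hID st).Claims v ↔ elected (st v) = true := by
  cases hs : succPort v <;>
    simp [Snapshot.Claims, snapshot, elected, count, port, hs, h]

theorem count_bump (s : LocalState) (p q : Port) :
    count (bump s p) q = count s q + if q = p then 1 else 0 := by
  cases p <;> cases q <;> simp [count, bump]

theorem total_bump {s : LocalState} {p : Port} (h : ¬ (p = false ∧ elected s)) (q : Port) :
    total (bump s p) q = total s q + (emission s p).on q := by
  have key : total s q ≤ total (bump s p) q := by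
    unfold elected at h
    obtain ⟨m, a, b⟩ := s
    cases p <;> cases q <;>
      simp only [total, bump, out0, out1, if_true, if_false, Bool.false_eq_true, true_and,
        decide_eq_true_eq] at h ⊢ <;> split_ifs <;> omega
  have e : (emission s p).on q = total (bump s p) q - total s q := by
    cases q <;> simp [Emission.on, emission]
  omega

theorem causal_of_link {c : Config algorithm n} (hid : ∀ v, (c.state v).1 = ID v)
    (hl : ∀ v p, count (c.state v) p + c.transit v p =
      total (c.state (peer succPort v p).1) (peer succPort v p).2) (d : Bool) (v : ZMod n) :
    (snapshot succPort hID c.state).recv d (v + dir n d) +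
      c.transit (v + dir n d) (port succPort (!d) (v + dir n d)) =
      (snapshot succPort hID c.state).out d v := by
  have := hl (v + dir n d) (port succPort (!d) (v + dir n d))
  rw [peer_port, dir_not, add_neg_cancel_right, Bool.not_not] at this
  rw [snapshot_out hid, ← this]
  rfl

theorem sum_ports (f : Port → ℕ) (d : Bool) (v : ZMod n) :
    f false + f true = f (port succPort d v) + f (port succPort (!d) v) := by
  rw [port_not]
  cases port succPort d v
  · rfl
  · exact add_comm _ _

theorem initial_invariant [NeZero n] {L : ZMod n} (hL : ∀ v, ID v ≤ ID L) :
    Invariant succPort hID L (Config.initial algorithm succPort ID) := by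
  have hid : ∀ v, ((Config.initial algorithm succPort ID).state v).1 = ID v := fun v => rfl
  have hl : ∀ v p, count ((Config.initial algorithm succPort ID).state v) p +
      (Config.initial algorithm succPort ID).transit v p =
      total ((Config.initial algorithm succPort ID).state (peer succPort v p).1)
        (peer succPort v p).2 := by
    intro v p
    cases p <;> cases h : (peer succPort v _).2 <;>
      simp [Config.initial, algorithm, count, Emission.on, h]
  have hr : ∀ d v, (snapshot succPort hID (Config.initial algorithm succPort ID).state).recv d v
      = 0 := by
    intro d v
    simp [snapshot, count, Config.initial, algorithm]
  refine ⟨hid, hl, rfl, fun d v => ?_, hL, fun v => ?_, fun v => ?_⟩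
  · rw [hr]; exact Nat.zero_le _
  · rw [hr]; exact Nat.zero_le _
  · rw [hr]; exact Nat.zero_le _

namespace Invariant

variable [NeZero n] {L : ZMod n} {c : Config algorithm n}

theorem recv_add_transit (h : Invariant succPort hID L c) (d : Bool) (v : ZMod n) :
    (snapshot succPort hID c.state).recv d v + c.transit v (port succPort (!d) v) =
      (snapshot succPort hID c.state).out d (v + dir n (!d)) := by
  have := causal_of_link (hID := hID) h.id_eq h.link d (v + dir n (!d))
  rwa [dir_not, neg_add_cancel_right, ← dir_not] at this

/-- Termination is quiescent. -/
theorem transit_eq_zero (h : Invariant succPort hID L c) {v : ZMod n}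
    (hv : finished (c.state v) = true) (p : Port) : c.transit v p = 0 := by
  obtain ⟨d, rfl⟩ := exists_port succPort v p
  have h1 := h.recv_add_transit (!d) v
  rw [Bool.not_not] at h1
  obtain ⟨h2, h3⟩ := h.bounded.recv_of_done ((done_iff_finished h.id_eq v).2 hv)
  by_cases hd : (!d) = (snapshot succPort hID c.state).orient L
  · rw [hd] at h1
    have := h.bounded.out_le (v + dir n d)
    omega
  · rw [Bool.eq_not_of_ne hd] at h1
    have := h.bounded.out_not_le (v + dir n d)
    omega

/-- No pulse arrives on port `0` of a claiming node, so that its outgoing count never drops. -/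
theorem not_elected (h : Invariant succPort hID L c) {v : ZMod n} {p : Port}
    (ht : 0 < c.transit v p) : ¬ (p = false ∧ elected (c.state v)) := by
  rintro ⟨rfl, hc⟩
  rw [← claims_iff_elected (hID := hID) (succPort := succPort) h.id_eq] at hc
  obtain rfl := hc.eq_of_max h.bounded.causal h.bounded.id_le
  have h1 := h.recv_add_transit (!(snapshot succPort hID c.state).orient v) v
  have h2 := h.bounded.out_not_le (v + dir n (!!(snapshot succPort hID c.state).orient v))
  have h3 := hc.1
  have h4 : port succPort (!!(snapshot succPort hID c.state).orient v) v = false := by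
    cases hs : succPort v <;> simp [snapshot, port, hs]
  rw [h4] at h1
  omega

/-- A delivery preserves the invariant, and changes the state of the receiving node only. -/
theorem deliver (h : Invariant succPort hID L c) {v : ZMod n} {p : Port}
    (ht : 0 < c.transit v p) : Invariant succPort hID L (c.deliver succPort v p) ∧
      (c.deliver succPort v p).state v = bump (c.state v) p ∧
      ∀ w ≠ v, (c.deliver succPort v p).state w = c.state w := by
  have hnf : ¬ finished (c.state v) = true := fun hf => by
    have := h.transit_eq_zero hf p
    omega
  have hr : algorithm.react (c.state v) p = (bump (c.state v) p, emission (c.state v) p) := by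
    unfold Algorithm.react
    exact if_neg hnf
  have hst : (c.deliver succPort v p).state v = bump (c.state v) p := by
    simp only [Config.deliver, hr, Function.update_self]
  have hst' : ∀ w ≠ v, (c.deliver succPort v p).state w = c.state w := fun w hw =>
    Function.update_of_ne hw _ _
  have htot : ∀ w q, total ((c.deliver succPort v p).state w) q =
      total (c.state w) q + if w = v then (emission (c.state v) p).on q else 0 := by
    intro w q
    by_cases hw : w = v
    · subst hw
      rw [hst, if_pos rfl, total_bump (h.not_elected ht)]
    · rw [hst' w hw, if_neg hw, add_zero]
  have hcnt : ∀ w q, count ((c.deliver succPort v p).state w) q =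
      count (c.state w) q + if w = v ∧ q = p then 1 else 0 := by
    intro w q
    by_cases hw : w = v
    · subst hw
      simp [hst, count_bump]
    · simp [hst' w hw, hw]
  have hid : ∀ w, ((c.deliver succPort v p).state w).1 = ID w := by
    intro w
    by_cases hw : w = v
    · subst hw
      rw [hst]
      exact h.id_eq w
    · rw [hst' w hw]
      exact h.id_eq w
  have hlink : ∀ w q, count ((c.deliver succPort v p).state w) q +
      (c.deliver succPort v p).transit w q =
      total ((c.deliver succPort v p).state (peer succPort w q).1) (peer succPort w q).2 := by
    intro w q
    rw [htot, hcnt, ← h.link]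
    simp only [Config.deliver, hr]
    by_cases hw : w = v ∧ q = p
    · obtain ⟨rfl, rfl⟩ := hw
      simp only [and_self, if_true]
      omega
    · simp only [hw, if_false]
      omega
  have hrecv : ∀ d w, (snapshot succPort hID (c.deliver succPort v p).state).recv d w ≤
      max ((snapshot succPort hID c.state).recv d w)
        ((snapshot succPort hID c.state).out d (w + dir n (!d))) := by
    intro d w
    have h1 := h.recv_add_transit d w
    have h2 := hcnt w (port succPort (!d) w)
    change count _ _ ≤ _
    rw [h2]
    change count _ _ + _ = _ at h1
    by_cases hw : w = v ∧ port succPort (!d) w = p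
    · rw [if_pos hw]
      rw [← hw.1, ← hw.2] at ht
      exact le_max_of_le_right (by omega)
    · rw [if_neg hw]
      exact le_max_left _ _
  refine ⟨⟨hid, hlink, ?_, fun d w => ?_, h.bounded.id_le, fun w => ?_, fun w => ?_⟩, hst, hst'⟩
  · simp only [htot]
    simp only [Config.deliver, hr, h.sent_eq]
    rw [Finset.sum_congr rfl (fun w _ => add_add_add_comm _ _ _ _), Finset.sum_add_distrib]
    simp [Finset.sum_add_distrib]
  · exact le_of_add_le_left (causal_of_link hid hlink d w).le
  · exact (hrecv _ w).trans (max_le (h.bounded.recv_not_le w) (h.bounded.out_not_le _))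
  · exact (hrecv _ w).trans (max_le (h.bounded.recv_le w) (h.bounded.out_le _))

theorem sent_le (h : Invariant succPort hID L c) : c.sent ≤ n * (4 * ID L + 3) := by
  rw [h.sent_eq]
  have : ∀ v ∈ Finset.univ, total (c.state v) false + total (c.state v) true ≤ 4 * ID L + 3 := by
    intro v _
    have h1 := h.bounded.out_le v
    have h2 := h.bounded.out_not_le v
    rw [snapshot_out h.id_eq] at h1 h2
    rw [sum_ports (succPort := succPort) (total (c.state v))
      ((snapshot succPort hID c.state).orient L) v]
    change _ ≤ 2 * ID L + 3 at h1
    change _ ≤ 2 * ID L at h2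
    omega
  simpa [ZMod.card] using Finset.sum_le_card_nsmul _ _ _ this

theorem sum_count_le (h : Invariant succPort hID L c) :
    ∑ v, (count (c.state v) false + count (c.state v) true) ≤ n * (4 * ID L + 3) := by
  have : ∀ v ∈ Finset.univ, count (c.state v) false + count (c.state v) true ≤ 4 * ID L + 3 := by
    intro v _
    have h1 := h.bounded.recv_le v
    have h2 := h.bounded.recv_not_le v
    rw [sum_ports (succPort := succPort) (count (c.state v))
      (!(snapshot succPort hID c.state).orient L) v]
    change count _ _ ≤ 2 * ID L + 3 at h1
    change count _ _ ≤ 2 * ID L at h2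
    omega
  simpa [ZMod.card] using Finset.sum_le_card_nsmul _ _ _ this

theorem finished_of_quiescent (h : Invariant succPort hID L c) (hq : ∀ v p, c.transit v p = 0)
    (v : ZMod n) : finished (c.state v) = true := by
  rw [← done_iff_finished (hID := hID) (succPort := succPort) h.id_eq]
  refine h.bounded.done_of_quiescent (fun d w => ?_) v
  rw [← causal_of_link h.id_eq h.link d w, hq, add_zero]

/-- The leader is the last to terminate, as its announcement passes all other nodes first. -/
theorem finished_of_leader (h : Invariant succPort hID L c) (hL : finished (c.state L) = true)
    (v : ZMod n) : finished (c.state v) = true := by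
  rw [← done_iff_finished (hID := hID) (succPort := succPort) h.id_eq] at hL ⊢
  exact h.bounded.all_done hL v

theorem elected_iff (h : Invariant succPort hID L c) {v : ZMod n}
    (hv : finished (c.state v) = true) : elected (c.state v) = true ↔ v = L := by
  rw [← done_iff_finished (hID := hID) (succPort := succPort) h.id_eq] at hv
  rw [← claims_iff_elected (hID := hID) (succPort := succPort) h.id_eq]
  exact ⟨fun hc => hc.eq_of_max h.bounded.causal h.bounded.id_le,
    fun e => e ▸ h.bounded.claims_of_done hv⟩

end Invariant

end Execution

end PulseElection

theorem theorem2 :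
    ∃ (A : ContentOblivious.Algorithm) (C : ℕ),
      ∀ (n : ℕ) [NeZero n] (succPort : ZMod n → ContentOblivious.Port) (ID : ZMod n → ℕ),
        Function.Injective ID →
        ∀ (sched : ℕ → Option (ZMod n × ContentOblivious.Port))
          (c : ℕ → ContentOblivious.Config A n),
          ContentOblivious.IsExecution A succPort ID sched c →
          ∃ (leader : ZMod n) (T : ZMod n → ℕ),
            -- the leader has the maximum identifier
            (∀ v, ID v ≤ ID leader) ∧
            -- every node terminates quiescently, node `v` at time `T v`
            (∀ v, ContentOblivious.QuiescentlyTerminatesAt sched c v (T v)) ∧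
            -- the final outputs: the leader outputs Leader, every other node Non-Leader
            (∀ v t, T v ≤ t → (A.isLeader ((c t).state v) = true ↔ v = leader)) ∧
            -- the leader is the last node to terminate
            (∀ v, v ≠ leader → T v < T leader) ∧
            -- the message complexity, explicitly and as `O(n * ID_max)` for `ID_max ≥ 1`
            (∀ t, (c t).sent ≤ n * (4 * ID leader + 3)) ∧
            (1 ≤ ID leader → ∀ t, (c t).sent ≤ C * (n * ID leader)) := by
  open PulseElection ContentOblivious in
  refine ⟨algorithm, 7, ?_⟩
  intro n _ succPort ID hID sched c hex
  obtain ⟨L, hL⟩ := Finite.exists_max ID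
  have hinv : ∀ t, Invariant succPort hID L (c t) := by
    intro t
    induction t with
    | zero => rw [hex.start]; exact initial_invariant hL
    | succ t ih =>
      cases hs : sched t with
      | none => rw [(hex.idle t hs).2]; exact ih
      | some x =>
        obtain ⟨ht, he⟩ := hex.deliver t x.1 x.2 hs
        rw [he]
        exact (ih.deliver ht).1
  have hstep : ∀ t v p, sched t = some (v, p) →
      (c (t + 1)).state v = bump ((c t).state v) p ∧
        ∀ w ≠ v, (c (t + 1)).state w = (c t).state w := by
    intro t v p hs
    obtain ⟨ht, he⟩ := hex.deliver t v p hs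
    rw [he]
    exact ((hinv t).deliver ht).2
  -- a finished node receives no pulse, so its state is frozen
  have hquiet : ∀ t v p, finished ((c t).state v) = true → sched t ≠ some (v, p) := by
    intro t v p hf hs
    have h1 := (hex.deliver t v p hs).1
    have h2 := (hinv t).transit_eq_zero hf p
    omega
  have hsame : ∀ t v, (∀ p, sched t ≠ some (v, p)) → (c (t + 1)).state v = (c t).state v := by
    intro t v hv
    cases hs : sched t with
    | none => rw [(hex.idle t hs).2]
    | some x =>
      refine (hstep t x.1 x.2 hs).2 v fun e => hv x.2 ?_
      rw [hs, e]
  have hstay : ∀ v s t, s ≤ t → finished ((c s).state v) = true →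
      finished ((c t).state v) = true := by
    intro v s t hst hf
    induction t, hst using Nat.le_induction with
    | base => exact hf
    | succ t _ ih => rw [hsame t v fun p => hquiet t v p ih]; exact ih
  -- each delivery raises the number of pulses received, which is bounded
  have hidle : ∃ t, sched t = none := by
    by_contra! hne
    have hgrow : ∀ t, t ≤ ∑ v, (count ((c t).state v) false + count ((c t).state v) true) := by
      intro t
      induction t with
      | zero => exact Nat.zero_le _
      | succ t ih =>
        obtain ⟨⟨v, p⟩, hs⟩ := Option.ne_none_iff_exists'.1 (hne t)
        refine Nat.succ_le_of_lt (ih.trans_lt (Finset.sum_lt_sum (fun w _ => ?_)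
          ⟨v, Finset.mem_univ v, ?_⟩))
        · by_cases hw : w = v
          · subst hw
            rw [(hstep t w p hs).1, count_bump, count_bump]
            omega
          · rw [(hstep t v p hs).2 w hw]
        · rw [(hstep t v p hs).1, count_bump, count_bump]
          cases p <;> simp
    exact absurd (hgrow _) (not_le.2 ((hinv _).sum_count_le.trans_lt (Nat.lt_succ_self _)))
  obtain ⟨t₀, ht₀⟩ := hidle
  have hfin : ∀ v, ∃ t, finished ((c t).state v) = true := fun v =>
    ⟨t₀, (hinv t₀).finished_of_quiescent (hex.idle t₀ ht₀).1 v⟩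
  have hT := fun v => Nat.find_spec (hfin v)
  refine ⟨L, fun v => Nat.find (hfin v), hL, fun v => ⟨⟨hT v, fun s hs => ?_⟩, fun s hs p => ?_⟩,
    fun v t ht => ?_, fun v hv => ?_, fun t => (hinv t).sent_le, fun h1 t => ?_⟩
  · exact Bool.eq_false_iff.2 (Nat.find_min (hfin v) hs)
  · exact hquiet s v p (hstay v _ s hs (hT v))
  · exact (hinv t).elected_iff (hstay v _ t ht (hT v))
  · obtain ⟨s, hs⟩ : ∃ s, Nat.find (hfin L) = s + 1 := by
      refine Nat.exists_eq_succ_of_ne_zero fun h0 => ?_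
      have h1 := hT L
      rw [h0, hex.start] at h1
      simp [finished, Config.initial, algorithm] at h1
    have hLs : ¬ finished ((c s).state L) = true := Nat.find_min (hfin L) (by omega)
    have hLs' : finished ((c (s + 1)).state L) = true := hs ▸ hT L
    -- the step that finishes `L` leaves every other node unchanged
    have hsched : ∃ p, sched s = some (L, p) := by
      by_contra! hne
      exact hLs (hsame s L hne ▸ hLs')
    obtain ⟨p, hp⟩ := hsched
    have hvs := (hinv (s + 1)).finished_of_leader hLs' v
    rw [hsame s v fun q hq => hv (congrArg Prod.fst (Option.some.inj (hp.symm.trans hq))).symm]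
      at hvs
    exact (Nat.find_min' (hfin v) hvs).trans_lt ((Nat.lt_succ_self s).trans_eq hs.symm)
  · refine ((hinv t).sent_le).trans ?_
    have : n * (4 * ID L + 3) ≤ n * (7 * ID L) := Nat.mul_le_mul_left _ (by omega)
    linarith
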